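/- For a nonnegative integer $n$ and a real number $\gamma\notin\{0,1,\dots,n-1\}$, let $$G_n^\gamma(x)=F(-n,\gamma-n+1,-\gamma;-x),\qquad F(-n,b,c;x)=1+\sum_{k=1}^n\frac{(-n)_k(b)_k}{(c)_k}\frac{x^k}{k!},$$ where $(a)_k=a(a+1)\cdots(a+k-1)$ is the Pochhammer symbol. Then: (1) if $\gamma\ge n$, the polynomial $G_n^\gamma(x)$ is unitary, i.e. every complex root of $G_n^\gamma(x)$ lies on the unit circle $\{z\in\mathbb{C} : |z|=1\}$; (2) for every integer $m\ge 0$, $G_{2m}^\gamma(1)\ne 0$ for every real $\gamma\notin\{0,1,\dots,2m-1\}$, and $G_{2m+1}^\gamma(1)=0$ for every real $\gamma\notin\{0,1,\dots,2m\}$ (in particular whenever $\gamma\ge 2m$, respectively $\gamma\ge 2m+1$). -/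

import Mathlib

open Polynomial

/-- The Pochhammer symbol `(a)_k = a (a + 1) ⋯ (a + k - 1)`, with `(a)_0 = 1`. -/
noncomputable def poch (a : ℂ) (k : ℕ) : ℂ := (ascPochhammer ℂ k).eval a

/-- The Gaussian hypergeometric polynomial
`F(-n, b, c; X) = 1 + ∑_{k=1}^n (-n)_k (b)_k / (c)_k * X^k / k!`,
meaningful when `(c)_n ≠ 0`, i.e. when `c` is none of `0, -1, …, -(n - 1)`. -/
noncomputable def hypergeomPoly (n : ℕ) (b c : ℂ) : ℂ[X] :=
  1 + ∑ k ∈ Finset.Icc 1 n,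
    C (poch (-(n : ℂ)) k * poch b k / poch c k / (k.factorial : ℂ)) * X ^ k

/-- The polynomial `G_n^γ(X) = F(-n, γ - n + 1, -γ; -X)`. -/
noncomputable def polyG (n : ℕ) (γ : ℂ) : ℂ[X] :=
  (hypergeomPoly n (γ - n + 1) (-γ)).comp (-X)

/-- A complex polynomial is unitary if all its complex roots lie on the unit circle. -/
def IsUnitaryPoly (p : ℂ[X]) : Prop :=
  ∀ z : ℂ, p.IsRoot z → ‖z‖ = 1

/-! With `a = γ - n + 1` and `y = -x`, multiplying `G_n^γ(x)` by `(a)_n / n!` gives the coefficient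
of `t ^ n` in `((1 - y t)(1 - t))^(-a)` (`polyG_eval_mul`). Put `y = z ^ 2` and divide by `z ^ n`:
this is the Gegenbauer polynomial of parameter `a` at `w / 2`, where `w = z + z⁻¹`. If `γ ≥ n` then
`a > 0`, and the three-term recurrence forces the zeros to have `w` real, so `z` is real or `‖z‖ =
1`. Real `z` is excluded because then `y ≥ 0` and all coefficients are positive. At `x = 1` we have
`y = -1`, the middle term of the recurrence vanishes, and the values are settled separately for each
parity. -/

lemma poch_zero (a : ℂ) : poch a 0 = 1 := by simp [poch]

lemma poch_succ (a : ℂ) (k : ℕ) : poch a (k + 1) = poch a k * (a + k) := by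
  simp [poch, ascPochhammer_succ_eval]

lemma poch_ne_zero {a : ℂ} {k : ℕ} (h : ∀ j < k, a + j ≠ 0) : poch a k ≠ 0 := by
  induction k with
  | zero => simp [poch_zero]
  | succ k ih =>
    rw [poch_succ]
    exact mul_ne_zero (ih fun j hj => h j (by omega)) (h k (by omega))

lemma poch_add (a : ℂ) (j k : ℕ) : poch a (j + k) = poch a j * poch (a + j) k := by
  simp [poch, ← ascPochhammer_mul]

lemma poch_one (n : ℕ) : poch 1 n = (n.factorial : ℂ) := by
  simp [poch]

/-- The reflection formula for a split Pochhammer symbol. -/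
lemma poch_eq_reflect (a : ℂ) (j k : ℕ) :
    poch a (j + k) = (-1) ^ k * poch (-(a + (j + k : ℕ) - 1)) k * poch a j := by
  have h : poch (-(a + (j + k : ℕ) - 1)) k = (-1) ^ k * poch (a + j) k := by
    unfold poch
    rw [ascPochhammer_eval_neg_eq_descPochhammer, descPochhammer_eval_eq_ascPochhammer]
    congr 2
    push_cast
    ring
  rw [h, poch_add]
  linear_combination (-(poch a j * poch (a + j) k)) * pow_mul_pow_eq_one k (by norm_num : (-1 : ℂ) * -1 = 1)

/-- The Taylor coefficients `(a)_k / k!` of `(1 - t)^(-a)`. -/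
noncomputable def risingCoeff (a : ℂ) (k : ℕ) : ℂ := poch a k / (k.factorial : ℂ)

lemma risingCoeff_zero (a : ℂ) : risingCoeff a 0 = 1 := by simp [risingCoeff, poch_zero]

lemma risingCoeff_succ (a : ℂ) (k : ℕ) :
    ((k : ℂ) + 1) * risingCoeff a (k + 1) = (a + k) * risingCoeff a k := by
  have h1 : (k.factorial : ℂ) ≠ 0 := by exact_mod_cast k.factorial_ne_zero
  have h2 : (k : ℂ) + 1 ≠ 0 := by exact_mod_cast k.succ_ne_zero
  simp only [risingCoeff, poch_succ, Nat.factorial_succ]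
  push_cast
  field_simp

/-- The power series `(1 - y t)^(-a)` in `t`. -/
noncomputable def negPowSeries (a y : ℂ) : PowerSeries ℂ :=
  PowerSeries.mk fun k => risingCoeff a k * y ^ k

/-- The differential equation of `(1 - y t)^(-a)`, from which the recurrence below is read off. -/
lemma negPowSeries_deriv (a y : ℂ) :
    (1 - PowerSeries.C y * PowerSeries.X) * PowerSeries.derivative ℂ (negPowSeries a y) =
      PowerSeries.C (a * y) * negPowSeries a y := by
  ext n
  rw [sub_mul, one_mul, mul_assoc, map_sub, PowerSeries.coeff_C_mul, PowerSeries.coeff_C_mul]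
  cases n with
  | zero =>
    have h := risingCoeff_succ a 0
    simp [PowerSeries.coeff_derivative, negPowSeries] at h ⊢
    rw [h]; ring
  | succ n =>
    have h := risingCoeff_succ a (n + 1)
    rw [PowerSeries.coeff_succ_X_mul]
    simp [PowerSeries.coeff_derivative, negPowSeries] at h ⊢
    linear_combination y ^ (n + 2) * h

/-- The homogenized Gegenbauer polynomial: the coefficient of `t ^ n` in
`(1 - y t)^(-a) (1 - t)^(-a)`. -/
noncomputable def gegenbauerSum (a y : ℂ) (n : ℕ) : ℂ :=
  PowerSeries.coeff n (negPowSeries a y * negPowSeries a 1)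

lemma gegenbauerSum_eq (a y : ℂ) (n : ℕ) :
    gegenbauerSum a y n =
      ∑ k ∈ Finset.range (n + 1), risingCoeff a k * risingCoeff a (n - k) * y ^ k := by
  rw [gegenbauerSum, PowerSeries.coeff_mul, Finset.Nat.sum_antidiagonal_eq_sum_range_succ_mk]
  refine Finset.sum_congr rfl fun k _ => ?_
  simp [negPowSeries]
  ring

lemma gegenbauerSum_zero (a y : ℂ) : gegenbauerSum a y 0 = 1 := by
  simp [gegenbauerSum_eq, risingCoeff_zero]

lemma gegenbauerSum_one (a y : ℂ) : gegenbauerSum a y 1 = a * (1 + y) := by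
  have h := risingCoeff_succ a 0
  simp [risingCoeff_zero] at h
  simp [gegenbauerSum_eq, Finset.sum_range_succ, risingCoeff_zero, h]
  ring

/-- The three-term recurrence of the Gegenbauer polynomials. -/
lemma gegenbauerSum_recurrence (a y : ℂ) (n : ℕ) :
    ((n : ℂ) + 2) * gegenbauerSum a y (n + 2) =
      (n + 1 + a) * (1 + y) * gegenbauerSum a y (n + 1)
        - (n + 2 * a) * y * gegenbauerSum a y n := by
  set F := negPowSeries a y * negPowSeries a 1 with hF
  have hf := negPowSeries_deriv a y
  have hg := negPowSeries_deriv a 1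
  -- This is `(1 - y t)(1 - t) F' = a (1 + y - 2 y t) F`, solved for the leading `F'`.
  have hD : PowerSeries.derivative ℂ F =
      PowerSeries.C (1 + y) * (PowerSeries.X * PowerSeries.derivative ℂ F)
        - PowerSeries.C y * (PowerSeries.X * (PowerSeries.X * PowerSeries.derivative ℂ F))
        + PowerSeries.C (a * (1 + y)) * F - PowerSeries.C (2 * a * y) * (PowerSeries.X * F) := by
    rw [hF, Derivation.leibniz]
    simp only [smul_eq_mul, map_mul, map_add, map_one, map_ofNat] at hf hg ⊢
    linear_combination (1 - PowerSeries.X) * negPowSeries a 1 * hf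
      + (1 - PowerSeries.C y * PowerSeries.X) * negPowSeries a y * hg
  have h := congrArg (PowerSeries.coeff (n + 1)) hD
  rw [map_sub, map_add, map_sub] at h
  simp only [PowerSeries.coeff_C_mul, PowerSeries.coeff_succ_X_mul,
    PowerSeries.coeff_derivative] at h
  simp only [gegenbauerSum, ← hF]
  cases n with
  | zero =>
    simp at h ⊢
    linear_combination h
  | succ n =>
    simp only [PowerSeries.coeff_succ_X_mul, PowerSeries.coeff_derivative] at h
    push_cast at h ⊢
    linear_combination h

lemma polyG_eval_mul (n : ℕ) (γ x : ℂ) (hγ : ∀ j < n, γ ≠ (j : ℂ)) :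
    (polyG n γ).eval x * risingCoeff (γ - n + 1) n = gegenbauerSum (γ - n + 1) (-x) n := by
  have hG : (polyG n γ).eval x = ∑ k ∈ Finset.range (n + 1),
      poch (-(n : ℂ)) k * poch (γ - n + 1) k / poch (-γ) k / (k.factorial : ℂ) * (-x) ^ k := by
    rw [Finset.range_eq_Ico, Finset.sum_eq_sum_Ico_succ_bot (by omega)]
    simp [polyG, hypergeomPoly, eval_finsetSum, poch_zero]
    rfl
  rw [hG, gegenbauerSum_eq, Finset.sum_mul]
  refine Finset.sum_congr rfl fun k hk => ?_
  obtain ⟨j, rfl⟩ : ∃ j, n = j + k :=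
    ⟨n - k, by have := Finset.mem_range.mp hk; omega⟩
  set a := γ - (j + k : ℕ) + 1 with ha
  -- Reflection turns `(-n)_k` into `(-1)^k n! / j!`, and `(a)_n` into `(-1)^k (-γ)_k (a)_j`. The
  -- signs and the denominator `(-γ)_k` then cancel.
  have h1 := poch_eq_reflect 1 j k
  have h2 := poch_eq_reflect a j k
  rw [show -(1 + ((j + k : ℕ) : ℂ) - 1) = -((j + k : ℕ) : ℂ) by ring, poch_one, poch_one] at h1
  rw [show -(a + ((j + k : ℕ) : ℂ) - 1) = -γ by rw [ha]; ring] at h2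
  have h3 : poch (-γ) k ≠ 0 := poch_ne_zero fun i hi h0 =>
    hγ i (by omega) (by linear_combination -h0)
  have hn : ((j + k).factorial : ℂ) ≠ 0 := by exact_mod_cast (j + k).factorial_ne_zero
  have hj : (j.factorial : ℂ) ≠ 0 := by exact_mod_cast j.factorial_ne_zero
  simp only [risingCoeff, Nat.add_sub_cancel]
  rw [h2]
  field_simp
  rw [h1]
  ring

/-- At `y = -1` the recurrence links only indices of equal parity: going from `2 m` to `2 m + 2`
multiplies the value by `(a + m) / (m + 1)`. -/
lemma gegenbauerSum_neg_one_even_ne_zero (a : ℂ) (m : ℕ) (h : ∀ j < m, a + j ≠ 0) :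
    gegenbauerSum a (-1) (2 * m) ≠ 0 := by
  induction m with
  | zero => simp [gegenbauerSum_zero]
  | succ m ih =>
    have hr := gegenbauerSum_recurrence a (-1) (2 * m)
    intro h0
    rw [show 2 * (m + 1) = 2 * m + 2 by ring] at h0
    rw [h0] at hr
    push_cast at hr
    refine mul_ne_zero (h m (by omega)) (ih fun j hj => h j (by omega)) ?_
    linear_combination -hr / 2

lemma gegenbauerSum_neg_one_odd (a : ℂ) (m : ℕ) :
    gegenbauerSum a (-1) (2 * m + 1) = 0 := by
  induction m with
  | zero => simp [gegenbauerSum_one]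
  | succ m ih =>
    have hr := gegenbauerSum_recurrence a (-1) (2 * m + 1)
    rw [ih] at hr
    have h2 : ((2 * m + 1 : ℕ) : ℂ) + 2 ≠ 0 := by exact_mod_cast (by omega : 2 * m + 1 + 2 ≠ 0)
    refine (mul_eq_zero.mp ?_).resolve_left h2
    rw [show 2 * (m + 1) + 1 = 2 * m + 1 + 2 by ring]
    linear_combination hr

/-- For a real parameter `a > 0` the Gegenbauer polynomials do not vanish off the real axis. -/
lemma gegenbauerSum_sq_ne_zero_of_im_pos {a : ℝ} (ha : 0 < a) {z : ℂ} (hz : z ≠ 0)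
    (him : 0 < (z + z⁻¹).im) (n : ℕ) : gegenbauerSum a (z ^ 2) n ≠ 0 := by
  set w := z + z⁻¹ with hw
  set Q : ℕ → ℂ := fun n => gegenbauerSum a (z ^ 2) n * z⁻¹ ^ n with hQ
  have hzz : z * z⁻¹ = 1 := mul_inv_cancel₀ hz
  have hrec (n : ℕ) : (n + 2 : ℝ) * Q (n + 2) =
      (n + 1 + a : ℝ) * w * Q (n + 1) - (n + 2 * a : ℝ) * Q n := by
    have h := gegenbauerSum_recurrence a (z ^ 2) n
    simp only [hQ, hw]
    push_cast
    have e1 : (1 + z ^ 2) * z⁻¹ ^ (n + 2) = (z + z⁻¹) * z⁻¹ ^ (n + 1) := by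
      linear_combination (z * z⁻¹ ^ (n + 1)) * hzz
    have e2 : z ^ 2 * z⁻¹ ^ (n + 2) = z⁻¹ ^ n := by
      linear_combination (z⁻¹ ^ n * (z * z⁻¹ + 1)) * hzz
    linear_combination z⁻¹ ^ (n + 2) * h
      + (n + 1 + a) * gegenbauerSum a (z ^ 2) (n + 1) * e1
      - (n + 2 * a) * gegenbauerSum a (z ^ 2) n * e2
  have hne {n : ℕ} (h : 0 < (Q (n + 1)).im * (Q n).re - (Q (n + 1)).re * (Q n).im) :
      Q (n + 1) ≠ 0 := by
    intro h0
    simp [h0] at h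
  -- The quantity is `Im (Q (n + 1) * conj (Q n))`, as in a Christoffel–Darboux argument.
  -- Multiplying the recurrence by `conj (Q (n + 1))` and taking imaginary parts propagates its
  -- positivity.
  have hpos (n : ℕ) : 0 < (Q (n + 1)).im * (Q n).re - (Q (n + 1)).re * (Q n).im := by
    induction n with
    | zero =>
      have h0 : Q 0 = 1 := by simp [hQ, gegenbauerSum_zero]
      have h1 : Q 1 = a * w := by
        simp only [hQ, hw, gegenbauerSum_one]
        field_simp
        ring
      simp only [zero_add, h0, h1]
      simpa using mul_pos ha him
    | succ n ih =>
      have hr := congrArg Complex.re (hrec n)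
      have hi := congrArg Complex.im (hrec n)
      have hN : 0 < (Q (n + 1)).re ^ 2 + (Q (n + 1)).im ^ 2 := by
        have := Complex.normSq_pos.mpr (hne ih)
        rw [Complex.normSq_apply] at this
        linarith
      simp only [Complex.sub_re, Complex.sub_im, Complex.mul_re, Complex.mul_im,
        Complex.ofReal_re, Complex.ofReal_im] at hr hi
      have hn2 : (0 : ℝ) < n + 2 := by positivity
      refine pos_of_mul_pos_right (a := (n + 2 : ℝ)) ?_ hn2.le
      have key : (n + 2 : ℝ) * ((Q (n + 1 + 1)).im * (Q (n + 1)).re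
            - (Q (n + 1 + 1)).re * (Q (n + 1)).im) =
          (n + 1 + a) * w.im * ((Q (n + 1)).re ^ 2 + (Q (n + 1)).im ^ 2)
          + (n + 2 * a) * ((Q (n + 1)).im * (Q n).re - (Q (n + 1)).re * (Q n).im) := by
        linear_combination (Q (n + 1)).re * hi - (Q (n + 1)).im * hr
      rw [key]
      positivity
  cases n with
  | zero => simp [gegenbauerSum_zero]
  | succ n => exact left_ne_zero_of_mul (hne (hpos n))

lemma risingCoeff_ofReal_pos {a : ℝ} (ha : 0 < a) (k : ℕ) :
    ∃ r : ℝ, 0 < r ∧ risingCoeff a k = r := by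
  induction k with
  | zero => exact ⟨1, one_pos, by simp [risingCoeff_zero]⟩
  | succ k ih =>
    obtain ⟨r, hr, h⟩ := ih
    refine ⟨(a + k) * r / (k + 1), by positivity, ?_⟩
    have hk : (k : ℂ) + 1 ≠ 0 := by exact_mod_cast k.succ_ne_zero
    have h1 := risingCoeff_succ a k
    rw [h] at h1
    push_cast
    rw [eq_div_iff hk]
    linear_combination h1

lemma gegenbauerSum_ne_zero_of_nonneg {a : ℝ} (ha : 0 < a) {y : ℝ} (hy : 0 ≤ y) (n : ℕ) :
    gegenbauerSum a y n ≠ 0 := by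
  choose r hr h using risingCoeff_ofReal_pos ha
  have hpos : 0 < ∑ k ∈ Finset.range (n + 1), r k * r (n - k) * y ^ k := by
    refine Finset.sum_pos' (fun k _ => ?_) ⟨0, by simp, ?_⟩
    · have := hr k
      have := hr (n - k)
      positivity
    · simpa using mul_pos (hr 0) (hr n)
  rw [gegenbauerSum_eq]
  simp only [h]
  exact_mod_cast hpos.ne'

lemma norm_eq_one_of_gegenbauerSum_eq_zero {a : ℝ} (ha : 0 < a) {y : ℂ} {n : ℕ}
    (h : gegenbauerSum a y n = 0) : ‖y‖ = 1 := by
  obtain ⟨z, rfl⟩ : ∃ z : ℂ, z ^ 2 = y := IsAlgClosed.exists_pow_nat_eq y two_pos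
  have hz : z ≠ 0 := by
    rintro rfl
    exact gegenbauerSum_ne_zero_of_nonneg ha le_rfl n (by simpa using h)
  have him : (z + z⁻¹).im = 0 := by
    -- Both `z` and `-z` are square roots of `y`, so a negative imaginary part reduces to a positive
    -- one.
    rcases lt_trichotomy (z + z⁻¹).im 0 with h1 | h1 | h1
    · refine absurd h ?_
      rw [← neg_sq]
      refine gegenbauerSum_sq_ne_zero_of_im_pos ha (neg_ne_zero.mpr hz) ?_ n
      rw [inv_neg, ← neg_add, Complex.neg_im]
      linarith
    · exact h1
    · exact absurd h (gegenbauerSum_sq_ne_zero_of_im_pos ha hz h1 n)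
  have hN : Complex.normSq z ≠ 0 := by simpa using hz
  rw [Complex.add_im, Complex.inv_im] at him
  -- `Im (z + z⁻¹) = Im z * (1 - 1 / |z|²)`.
  have him' : z.im * (Complex.normSq z - 1) = 0 := by
    field_simp at him
    linear_combination him
  rcases mul_eq_zero.mp him' with h1 | h1
  · obtain ⟨x, rfl⟩ : ∃ x : ℝ, (x : ℂ) = z := ⟨z.re, Complex.ext (by simp) (by simp [h1])⟩
    refine absurd ?_ (gegenbauerSum_ne_zero_of_nonneg ha (sq_nonneg x) n)
    simpa using h
  · rw [norm_pow, ← Complex.normSq_eq_norm_sq]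
    linarith

theorem proposition4p3 :
    (∀ (n : ℕ) (γ : ℝ), (n : ℝ) ≤ γ → IsUnitaryPoly (polyG n (γ : ℂ))) ∧
    (∀ (m : ℕ) (γ : ℝ), (∀ j : ℕ, j < 2 * m → γ ≠ (j : ℝ)) →
      (polyG (2 * m) (γ : ℂ)).eval 1 ≠ 0) ∧
    (∀ (m : ℕ) (γ : ℝ), (∀ j : ℕ, j < 2 * m + 1 → γ ≠ (j : ℝ)) →
      (polyG (2 * m + 1) (γ : ℂ)).eval 1 = 0) := by
  refine ⟨fun n γ hγ z hz => ?_, fun m γ hγ h0 => ?_, fun m γ hγ => ?_⟩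
  · have h := polyG_eval_mul n γ z fun j hj => by
      have : (j : ℝ) < n := by exact_mod_cast hj
      exact_mod_cast (this.trans_le hγ).ne'
    rw [hz.eq_zero, zero_mul] at h
    rw [← norm_neg]
    refine norm_eq_one_of_gegenbauerSum_eq_zero (a := γ - n + 1) (n := n) (by linarith) ?_
    push_cast
    exact h.symm
  · have h := polyG_eval_mul (2 * m) γ 1 fun j hj => by exact_mod_cast hγ j hj
    rw [h0, zero_mul] at h
    refine gegenbauerSum_neg_one_even_ne_zero _ m (fun j hj hj0 => ?_) h.symm
    -- Here `a = γ - 2 m + 1`, so `a + j = 0` would make `γ` the excluded integer `2 m - 1 - j`.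
    refine hγ (2 * m - 1 - j) (by omega) ?_
    have hc : ((2 * m - 1 - j : ℕ) : ℂ) + j + 1 = (2 * m : ℕ) := by
      exact_mod_cast (by omega : 2 * m - 1 - j + j + 1 = 2 * m)
    have : (γ : ℂ) = ((2 * m - 1 - j : ℕ) : ℂ) := by linear_combination hj0 - hc
    exact_mod_cast this
  · have h := polyG_eval_mul (2 * m + 1) γ 1 fun j hj => by exact_mod_cast hγ j hj
    rw [gegenbauerSum_neg_one_odd] at h
    refine (mul_eq_zero.mp h).resolve_right ?_
    -- The normalizing factor `(a)_n / n!` must be nonzero to be cancelled. With `a = γ - 2 m`, its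
    -- zeros are exactly the excluded values of `γ`.
    refine div_ne_zero (poch_ne_zero fun j hj hj0 => ?_)
      (by exact_mod_cast (2 * m + 1).factorial_ne_zero)
    refine hγ (2 * m - j) (by omega) ?_
    have hc : ((2 * m - j : ℕ) : ℂ) + j + 1 = (2 * m + 1 : ℕ) := by
      exact_mod_cast (by omega : 2 * m - j + j + 1 = 2 * m + 1)
    have : (γ : ℂ) = ((2 * m - j : ℕ) : ℂ) := by linear_combination hj0 - hc
    exact_mod_cast this
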